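/- For $n \in \mathbb{N}$ let $\mathrm{ou}(n)$ denote the number of odd unimodal sequences of weight $n$, that is, the number of sequences of odd positive integers \[ a_1 \le \cdots \le a_r \le \overline{c} \ge b_1 \ge \cdots \ge b_s \qquad (r, s \ge 0) \] with a distinguished entry $c$ (the peak) and with $c + \sum_{j=1}^r a_j + \sum_{j=1}^s b_j = n$; sequences with the same entries whose peak is at different positions are counted as different. Then, as $n \to \infty$, \[ \mathrm{ou}(n) \sim \frac{e^{\pi\sqrt{2n/3}}}{2^{13/4}\, 3^{1/4}\, n^{3/4}} . \] -/

import Mathlib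

open Filter Asymptotics

/-- A unimodal sequence `a₁ ≤ ⋯ ≤ a_r ≤ c̄ ≥ b₁ ≥ ⋯ ≥ b_s` of positive integers with a
distinguished peak `c`; the lists `left` and `right` may be empty. Two sequences with the same
entries but with the peak at different positions are different. -/
@[ext]
structure UnimodalSeq where
  left : List ℕ
  peak : ℕ
  right : List ℕ
  pos : ∀ x ∈ left ++ peak :: right, 0 < x
  left_le : (left ++ [peak]).Pairwise (· ≤ ·)
  right_ge : (peak :: right).Pairwise (· ≥ ·)

namespace UnimodalSeq

/-- All entries from left to right, the peak included. -/
def entries (u : UnimodalSeq) : List ℕ := u.left ++ u.peak :: u.right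

/-- The sum of all entries. -/
def weight (u : UnimodalSeq) : ℕ := u.entries.sum

/-- All entries are odd. -/
def IsOdd (u : UnimodalSeq) : Prop := ∀ x ∈ u.entries, Odd x

/-- There are finitely many unimodal sequences of a given weight, so that the cardinalities
counted below are not junk values. -/
theorem finite_weight (n : ℕ) : {u : UnimodalSeq | u.weight = n}.Finite := by
  have hlen : ∀ u : {u : UnimodalSeq | u.weight = n}, u.1.left.length < n + 1 := by
    rintro ⟨u, hu⟩
    have h1 : u.entries.length ≤ u.entries.sum := List.length_le_sum_of_one_le _ u.pos
    have h2 : u.entries.sum = n := hu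
    simp only [entries, List.length_append, List.length_cons] at h1 h2 ⊢
    omega
  let f : {u : UnimodalSeq | u.weight = n} → Composition n × Fin (n + 1) := fun u =>
    (⟨u.1.entries, fun {i} hi => u.1.pos i hi, u.2⟩, ⟨u.1.left.length, hlen u⟩)
  refine Finite.of_injective f ?_
  rintro ⟨u, hu⟩ ⟨v, hv⟩ h
  have h1 : u.entries = v.entries := congrArg (fun p => p.1.blocks) h
  have h2 : u.left.length = v.left.length := congrArg (fun p => p.2.val) h
  have h3 := List.append_inj h1 h2
  have h4 := List.cons.inj h3.2
  exact Subtype.ext (UnimodalSeq.ext h3.1 h4.1 h4.2)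

end UnimodalSeq

/-- `ou n` is the number of odd unimodal sequences of weight `n`. -/
noncomputable def ou (n : ℕ) : ℕ :=
  {u : UnimodalSeq | u.IsOdd ∧ u.weight = n}.ncard

open Topology

/-! Write P_m for `oddProd q m`, P for its limit `oddPartGF q`, and A = π²/6. A sequence with peak
2m+1 has two independent sides with odd parts at most 2m+1, so its generating function is q^(2m+1)
P_{m+1}² = (P_{m+1} - P_m) P_{m+1}. If the left side must also contain the peak value, this becomes
(P_{m+1} - P_m)². Since 2(b - a)b - (b - a)² = b² - a², the series for 2 `ou` - `ouRepeated`
telescopes to P² - 1 (`hasSum_oddPartGF_sq`).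

The coefficients of P² come from the circle method. The inversion of η gives P(e^(-τ))² ≈ ½ exp(A/τ)
(`oddPartGF_exp_sq`), so exp(A/τ + nτ) has its saddle at τ = w² with w⁴ = A/n. On τ = w² + i w³ u
the rescaled integrand tends to ½ exp(-A u²) (`tendsto_saddle_point`), and a bound valid on the
whole circle gives the majorant C/(1 + u²) (`norm_oddPartGF_sq_le`, `one_add_sq_le_exp_arcGap`).
Dominated convergence then gives the coefficients to order w³ exp(2A/w²).

The correction `ouRepeated` is smaller by a factor of order w (`tendsto_ouRepeated`): its generating
function is a sum of squares of small increments, and its coefficients are monotone. Hence `ou` is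
asymptotically half the coefficient of P². -/

/-! ### The product over odd parts and Euler's function -/

/-- The finite product `∏_{j < m} 1 / (1 - q ^ (2 j + 1))`, the generating function of partitions
into odd parts less than `2 m`. -/
noncomputable def oddProd {K : Type*} [Field K] (q : K) (m : ℕ) : K :=
  ∏ j ∈ Finset.range m, (1 - q ^ (2 * j + 1))⁻¹

/-- Euler's function `∏ (1 - q ^ (n + 1))`. -/
noncomputable def eulerPhi (q : ℂ) : ℂ := ∏' n : ℕ, (1 - q ^ (n + 1))

/-- The generating function `∏ 1 / (1 - q ^ (2 j + 1))` of partitions into odd parts, written as a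
quotient of Euler functions. -/
noncomputable def oddPartGF (q : ℂ) : ℂ := eulerPhi (q ^ 2) / eulerPhi q

lemma one_sub_pow_ne_zero {q : ℂ} (hq : ‖q‖ < 1) (n : ℕ) : 1 - q ^ (n + 1) ≠ 0 := by
  intro h
  have h1 : ‖q ^ (n + 1)‖ = 1 := by rw [← sub_eq_zero.mp h]; simp
  rw [norm_pow] at h1
  exact absurd h1 (pow_lt_one₀ (norm_nonneg _) hq (by omega)).ne

lemma eulerPhi_ne_zero {q : ℂ} (hq : ‖q‖ < 1) : eulerPhi q ≠ 0 := by
  have := tprod_one_add_ne_zero_of_summable (f := fun n : ℕ => -q ^ (n + 1))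
    (fun n => by simpa [← sub_eq_add_neg] using one_sub_pow_ne_zero hq n)
    (by
      simpa using (summable_nat_add_iff 1).mpr
        (summable_geometric_of_lt_one (norm_nonneg _) hq))
  simpa [eulerPhi, ← sub_eq_add_neg] using this

lemma tendsto_prod_eulerPhi {q : ℂ} (hq : ‖q‖ < 1) :
    Tendsto (fun m => ∏ j ∈ Finset.range m, (1 - q ^ (j + 1))) atTop (𝓝 (eulerPhi q)) :=
  (ModularForm.multipliable_one_sub_pow hq).hasProd.tendsto_prod_nat

lemma prod_one_sub_pow_eq (q : ℂ) (m : ℕ) :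
    ∏ j ∈ Finset.range (2 * m), (1 - q ^ (j + 1)) =
      (∏ j ∈ Finset.range m, (1 - q ^ (2 * j + 1))) *
        ∏ j ∈ Finset.range m, (1 - (q ^ 2) ^ (j + 1)) := by
  induction m with
  | zero => simp
  | succ m ih =>
    rw [show 2 * (m + 1) = 2 * m + 1 + 1 by ring, Finset.prod_range_succ, Finset.prod_range_succ,
      ih, Finset.prod_range_succ, Finset.prod_range_succ, ← pow_mul]
    ring

lemma tendsto_oddProd {q : ℂ} (hq : ‖q‖ < 1) :
    Tendsto (oddProd q) atTop (𝓝 (oddPartGF q)) := by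
  have hq2 : ‖q ^ 2‖ < 1 := by
    rw [norm_pow]; exact pow_lt_one₀ (norm_nonneg _) hq two_ne_zero
  have h2 : Tendsto (fun m : ℕ => 2 * m) atTop atTop :=
    tendsto_id.const_mul_atTop' (by norm_num)
  have h := (tendsto_prod_eulerPhi hq2).div ((tendsto_prod_eulerPhi hq).comp h2)
    (eulerPhi_ne_zero hq)
  refine h.congr fun m => ?_
  have hne : ∏ j ∈ Finset.range m, (1 - (q ^ 2) ^ (j + 1)) ≠ 0 :=
    Finset.prod_ne_zero_iff.mpr fun j _ => one_sub_pow_ne_zero hq2 j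
  simp only [Pi.div_apply, Function.comp_apply, prod_one_sub_pow_eq, oddProd, Finset.prod_inv_distrib]
  rw [div_mul_cancel_right₀ hne]

/-! ### Modular transformation of the product -/

lemma norm_exp_neg_lt_one {τ : ℂ} (hτ : 0 < τ.re) : ‖Complex.exp (-τ)‖ < 1 := by
  rw [Complex.norm_exp]; simpa using hτ

lemma eta_eq_exp_mul_eulerPhi (τ : ℂ) :
    ModularForm.eta (Complex.I * τ / (2 * Real.pi)) =
      Complex.exp (-τ / 24) * eulerPhi (Complex.exp (-τ)) := by
  have hpi : (Real.pi : ℂ) ≠ 0 := by exact_mod_cast Real.pi_ne_zero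
  have h1 : 2 * (Real.pi : ℂ) * Complex.I * (Complex.I * τ / (2 * Real.pi)) = -τ := by
    field_simp; rw [Complex.I_sq]; ring
  simp only [ModularForm.eta, eulerPhi, ModularForm.eta_q_eq_pow, h1]
  congr 1
  simp only [Function.Periodic.qParam]
  congr 1
  rw [h1]; simp

/-- Squaring the inversion formula of η removes the branch of the square root. This suffices because
only the square of `oddPartGF` is needed. -/
lemma eta_inversion_sq {τ : ℂ} (hτ : 0 < τ.re) :
    ModularForm.eta (Complex.I * (4 * Real.pi ^ 2 / τ) / (2 * Real.pi)) ^ 2 =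
      τ / (2 * Real.pi) * ModularForm.eta (Complex.I * τ / (2 * Real.pi)) ^ 2 := by
  have hpi : (Real.pi : ℂ) ≠ 0 := by exact_mod_cast Real.pi_ne_zero
  have hτ0 : τ ≠ 0 := by rintro rfl; simp at hτ
  have hmem : Complex.I * τ / (2 * Real.pi) ∈ UpperHalfPlane.upperHalfPlaneSet := by
    have : Complex.I * τ / (2 * Real.pi) = ((1 / (2 * Real.pi) : ℝ) : ℂ) * (Complex.I * τ) := by
      push_cast; ring
    simp only [UpperHalfPlane.upperHalfPlaneSet, Set.mem_ofPred_eq]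
    rw [this, Complex.im_ofReal_mul, Complex.I_mul_im]
    positivity
  have h := ModularForm.eta_comp_eq_csqrt_I_inv hmem
  have hinv : -1 / (Complex.I * τ / (2 * Real.pi)) =
      Complex.I * (4 * Real.pi ^ 2 / τ) / (2 * Real.pi) := by
    field_simp
    linear_combination (-4 : ℂ) * Complex.I_sq
  simp only [Function.comp_apply, Pi.smul_apply, Pi.mul_apply, smul_eq_mul] at h
  rw [hinv] at h
  have hsq : ∀ z : ℂ, z.sqrt ^ 2 = z := fun z => by
    simp [Complex.sqrt, ← Complex.cpow_nat_mul]
  rw [h, mul_pow, mul_pow, inv_pow, hsq, hsq]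
  field_simp

/-- The modular transformation of the generating function of partitions into odd parts. -/
lemma oddPartGF_exp_sq {τ : ℂ} (hτ : 0 < τ.re) :
    oddPartGF (Complex.exp (-τ)) ^ 2 = 1 / 2 * Complex.exp (τ / 12 + Real.pi ^ 2 / (6 * τ)) *
      (eulerPhi (Complex.exp (-(2 * Real.pi ^ 2 / τ))) /
        eulerPhi (Complex.exp (-(4 * Real.pi ^ 2 / τ)))) ^ 2 := by
  have hpi : (Real.pi : ℂ) ≠ 0 := by exact_mod_cast Real.pi_ne_zero
  have hτ0 : τ ≠ 0 := by rintro rfl; simp at hτ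
  have h1 := eta_inversion_sq hτ
  -- The numerator of `oddPartGF` is Euler's function at q², that is, at 2τ.
  have h2 := eta_inversion_sq (τ := 2 * τ) (by simpa using hτ)
  rw [show 4 * (Real.pi : ℂ) ^ 2 / (2 * τ) = 2 * Real.pi ^ 2 / τ by field_simp; ring] at h2
  simp only [eta_eq_exp_mul_eulerPhi] at h1 h2
  have hinv : 0 < (4 * (Real.pi : ℂ) ^ 2 / τ).re := by
    rw [show 4 * (Real.pi : ℂ) ^ 2 / τ = ((4 * Real.pi ^ 2 : ℝ) : ℂ) * τ⁻¹ by push_cast; ring,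
      Complex.re_ofReal_mul, Complex.inv_re]
    have := Complex.normSq_pos.mpr hτ0
    positivity
  have hn1 := eulerPhi_ne_zero (norm_exp_neg_lt_one hτ)
  have hn2 := eulerPhi_ne_zero (norm_exp_neg_lt_one hinv)
  have he : Complex.exp (-τ) ^ 2 = Complex.exp (-(2 * τ)) := by
    rw [← Complex.exp_nat_mul]; congr 1; push_cast; ring
  rw [oddPartGF, he, div_pow, div_pow]
  simp only [mul_pow, ← Complex.exp_nat_mul] at h1 h2
  have e1 : ∀ x : ℂ, Complex.exp x ≠ 0 := Complex.exp_ne_zero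
  set a := eulerPhi (Complex.exp (-τ))
  set b := eulerPhi (Complex.exp (-(2 * τ)))
  set c := eulerPhi (Complex.exp (-(2 * Real.pi ^ 2 / τ)))
  set d := eulerPhi (Complex.exp (-(4 * Real.pi ^ 2 / τ)))
  rw [← sub_eq_zero] at h1 h2
  have ha : a ^ 2 = 2 * Real.pi / τ * (Complex.exp (τ / 12 - Real.pi ^ 2 / (3 * τ)) * d ^ 2) := by
    have : Complex.exp (τ / 12 - Real.pi ^ 2 / (3 * τ)) =
        Complex.exp ((2 : ℕ) * (-(4 * Real.pi ^ 2 / τ) / 24)) /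
          Complex.exp ((2 : ℕ) * (-τ / 24)) := by
      rw [← Complex.exp_sub]; congr 1; push_cast; field_simp; ring
    rw [this]
    have hne := e1 ((2 : ℕ) * (-τ / 24))
    generalize Complex.exp ((2 : ℕ) * (-τ / 24)) = X at *
    generalize Complex.exp ((2 : ℕ) * (-(4 * Real.pi ^ 2 / τ) / 24)) = Y at *
    field_simp
    field_simp at h1
    linear_combination -h1
  have hb : b ^ 2 = Real.pi / τ * (Complex.exp (τ / 6 - Real.pi ^ 2 / (6 * τ)) * c ^ 2) := by
    have : Complex.exp (τ / 6 - Real.pi ^ 2 / (6 * τ)) =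
        Complex.exp ((2 : ℕ) * (-(2 * Real.pi ^ 2 / τ) / 24)) /
          Complex.exp ((2 : ℕ) * (-(2 * τ) / 24)) := by
      rw [← Complex.exp_sub]; congr 1; push_cast; field_simp; ring
    rw [this]
    have hne := e1 ((2 : ℕ) * (-(2 * τ) / 24))
    generalize Complex.exp ((2 : ℕ) * (-(2 * τ) / 24)) = X at *
    generalize Complex.exp ((2 : ℕ) * (-(2 * Real.pi ^ 2 / τ) / 24)) = Y at *
    field_simp
    field_simp at h2
    linear_combination -h2
  rw [ha, hb]
  have : Complex.exp (τ / 6 - Real.pi ^ 2 / (6 * τ)) =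
      Complex.exp (τ / 12 + Real.pi ^ 2 / (6 * τ)) *
        Complex.exp (τ / 12 - Real.pi ^ 2 / (3 * τ)) := by
    rw [← Complex.exp_add]; congr 1; field_simp; ring
  rw [this]
  have := e1 (τ / 12 - Real.pi ^ 2 / (3 * τ))
  field_simp

lemma tendsto_eulerPhi_zero : Tendsto eulerPhi (𝓝 0) (𝓝 1) := by
  have := tendsto_tprod_one_add_of_dominated_convergence (𝓕 := 𝓝 0) (g := 0)
    (f := fun (q : ℂ) (n : ℕ) ↦ -q ^ (n + 1)) (bound := fun n ↦ (1 / 2 : ℝ) ^ (n + 1))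
  simp only [Pi.zero_apply, norm_neg, norm_pow, add_zero, tprod_one] at this
  simp only [← sub_eq_add_neg] at this
  refine this
    (by simpa only [pow_succ'] using (summable_geometric_of_abs_lt_one (by norm_num)).mul_left _)
    (fun k ↦ by simpa using ((continuous_pow (M := ℂ) (k + 1)).tendsto 0).neg) ?_
  filter_upwards [Metric.ball_mem_nhds (0 : ℂ) (by norm_num : (0 : ℝ) < 1 / 2)] with q hq k
  exact pow_le_pow_left₀ (norm_nonneg _) (mem_ball_zero_iff.mp hq).le _

/-- The non-exponential factor in `oddPartGF_exp_sq` tends to one when `re (1 / τ) → ∞`. -/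
lemma tendsto_eulerPhi_quotient {α : Type*} {l : Filter α} {τ : α → ℂ}
    (h : Tendsto (fun x => (τ x)⁻¹.re) l atTop) :
    Tendsto (fun x => (eulerPhi (Complex.exp (-(2 * Real.pi ^ 2 / τ x))) /
        eulerPhi (Complex.exp (-(4 * Real.pi ^ 2 / τ x)))) ^ 2) l (𝓝 1) := by
  have key : ∀ c : ℝ, 0 < c →
      Tendsto (fun x => eulerPhi (Complex.exp (-(c * Real.pi ^ 2 / τ x)))) l (𝓝 1) := by
    intro c hc
    refine tendsto_eulerPhi_zero.comp (tendsto_zero_iff_norm_tendsto_zero.mpr ?_)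
    have hre : ∀ x, ‖Complex.exp (-(c * Real.pi ^ 2 / τ x))‖ =
        Real.exp (-((c * Real.pi ^ 2) * (τ x)⁻¹.re)) := by
      intro x
      rw [Complex.norm_exp, show (c : ℂ) * Real.pi ^ 2 / τ x =
        ((c * Real.pi ^ 2 : ℝ) : ℂ) * (τ x)⁻¹ by push_cast; ring, Complex.neg_re,
        Complex.re_ofReal_mul]
    simp only [hre]
    exact Real.tendsto_exp_neg_atTop_nhds_zero.comp (h.const_mul_atTop (by positivity))
  have h2 := key 2 (by norm_num)
  have h4 := key 4 (by norm_num)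
  push_cast at h2 h4
  simpa using (h2.div h4 one_ne_zero).pow 2

/-! ### Decay away from the positive real axis -/

lemma oddProd_succ {K : Type*} [Field K] (q : K) (m : ℕ) :
    oddProd q (m + 1) = oddProd q m * (1 - q ^ (2 * m + 1))⁻¹ :=
  Finset.prod_range_succ _ _

lemma ofReal_oddProd (r : ℝ) (m : ℕ) : ((oddProd r m : ℝ) : ℂ) = oddProd (r : ℂ) m := by
  simp [oddProd]

/-- With d = |z| - Re z one has |1 - z|² = (1 - |z|)² + 2d, and (1 - |z|)² ≤ 1, so it is enough that
exp(2d/5) ≤ 1 + 2d. This bounds one factor of the product. -/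
lemma exp_mul_one_sub_sq_le_norm_sq {z : ℂ} (hz : ‖z‖ < 1) :
    Real.exp (2 / 5 * (‖z‖ - z.re)) * (1 - ‖z‖) ^ 2 ≤ ‖1 - z‖ ^ 2 := by
  set d := ‖z‖ - z.re with hd
  have hre := Complex.abs_re_le_norm z
  have hd0 : 0 ≤ d := by have := le_abs_self z.re; linarith
  have hd2 : d ≤ 2 := by have := neg_abs_le z.re; linarith
  have h1 : ‖1 - z‖ ^ 2 = (1 - ‖z‖) ^ 2 + 2 * d := by
    rw [hd, Complex.sq_norm, Complex.normSq_apply]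
    have := Complex.sq_norm z
    rw [Complex.normSq_apply] at this
    simp only [Complex.sub_re, Complex.one_re, Complex.sub_im, Complex.one_im]
    nlinarith
  have h2 : Real.exp (2 / 5 * d) ≤ 1 + 2 * d := by
    have h3 := Real.add_one_le_exp (-(2 / 5 * d))
    -- (1 + 2d)(1 - 2d/5) = 1 + (4/5) d (2 - d) ≥ 1; the constant 2/5 is matched to d ≤ 2.
    have h4 : (1 + 2 * d)⁻¹ ≤ Real.exp (-(2 / 5 * d)) := by
      refine le_trans ?_ h3
      rw [inv_le_iff_one_le_mul₀ (by positivity)]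
      nlinarith
    rw [Real.exp_neg] at h4
    exact (inv_le_inv₀ (by positivity) (Real.exp_pos _)).mp h4
  have h5 : (1 - ‖z‖) ^ 2 ≤ 1 := by
    have := norm_nonneg z
    nlinarith
  have h6 := sq_nonneg (1 - ‖z‖)
  rw [h1]
  nlinarith

lemma norm_oddProd_sq_le {q : ℂ} (hq : ‖q‖ < 1) (m : ℕ) :
    ‖oddProd q m‖ ^ 2 ≤ oddProd ‖q‖ m ^ 2 *
      Real.exp (-(2 / 5 * ∑ j ∈ Finset.range m, (‖q‖ ^ (2 * j + 1) - (q ^ (2 * j + 1)).re))) := by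
  induction m with
  | zero => simp [oddProd]
  | succ m ih =>
    rw [oddProd_succ, oddProd_succ, norm_mul, mul_pow, mul_pow, Finset.sum_range_succ, mul_add,
      neg_add, Real.exp_add, norm_inv, mul_mul_mul_comm]
    have hz : ‖q ^ (2 * m + 1)‖ < 1 := by
      rw [norm_pow]; exact pow_lt_one₀ (norm_nonneg _) hq (by omega)
    have h := exp_mul_one_sub_sq_le_norm_sq hz
    rw [norm_pow] at h
    have h1 : 0 < 1 - ‖q‖ ^ (2 * m + 1) := by rw [norm_pow] at hz; linarith
    refine mul_le_mul ih ?_ (by positivity) (by positivity)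
    rw [Real.exp_neg, inv_pow, inv_pow, ← mul_inv, mul_comm ((1 - ‖q‖ ^ (2 * m + 1)) ^ 2)]
    exact inv_anti₀ (mul_pos (Real.exp_pos _) (pow_pos h1 2)) h

/-- The exponential saving of `oddPartGF` off the positive real axis. -/
noncomputable def arcGap (t y : ℝ) : ℝ :=
  1 / Real.sinh t - Real.sinh t * Real.cos y / (Real.sinh t ^ 2 + Real.sin y ^ 2)

lemma hasSum_exp_odd {τ : ℂ} (hτ : 0 < τ.re) :
    HasSum (fun j : ℕ => Complex.exp (-τ) ^ (2 * j + 1)) (1 / (2 * Complex.sinh τ)) := by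
  have hq := norm_exp_neg_lt_one hτ
  have hq2 : ‖Complex.exp (-τ) ^ 2‖ < 1 := by
    rw [norm_pow]; exact pow_lt_one₀ (norm_nonneg _) hq two_ne_zero
  have h := (hasSum_geometric_of_norm_lt_one hq2).mul_left (Complex.exp (-τ))
  convert! h using 1
  · ext j; rw [← pow_mul, pow_succ']
  · have h2 : 1 - Complex.exp (-τ) ^ 2 ≠ 0 := one_sub_pow_ne_zero hq 1
    have h3 : 2 * Complex.sinh τ = (1 - Complex.exp (-τ) ^ 2) * (Complex.exp (-τ))⁻¹ := by
      rw [Complex.two_sinh, Complex.exp_neg]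
      have := Complex.exp_ne_zero τ
      field_simp
    rw [h3]
    have := Complex.exp_ne_zero (-τ)
    field_simp

lemma normSq_sinh (t y : ℝ) :
    Complex.normSq (Complex.sinh (t + y * Complex.I)) = Real.sinh t ^ 2 + Real.sin y ^ 2 := by
  rw [Complex.sinh_add, Complex.cosh_mul_I, Complex.sinh_mul_I]
  rw [Complex.normSq_apply]
  simp [Complex.sinh_ofReal_re, Complex.cosh_ofReal_re, Complex.cos_ofReal_re,
    Complex.sin_ofReal_re, Complex.sinh_ofReal_im, Complex.cosh_ofReal_im, Complex.cos_ofReal_im,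
    Complex.sin_ofReal_im]
  have h1 := Real.cosh_sq t
  have h2 := Real.sin_sq_add_cos_sq y
  linear_combination Real.sin y ^ 2 * h1 + Real.sinh t ^ 2 * h2

lemma re_sinh (t y : ℝ) :
    (Complex.sinh (t + y * Complex.I)).re = Real.sinh t * Real.cos y := by
  rw [Complex.sinh_add, Complex.cosh_mul_I, Complex.sinh_mul_I]
  simp [Complex.sinh_ofReal_re, Complex.cosh_ofReal_re, Complex.cos_ofReal_re,
    Complex.sin_ofReal_re, Complex.sinh_ofReal_im, Complex.cosh_ofReal_im, Complex.cos_ofReal_im,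
    Complex.sin_ofReal_im]

/-- The odd powers of e^(-τ) sum to 1/(2 sinh τ). The gap is the real part of the difference of this
sum at t and at t + iy. -/
lemma hasSum_arcGap {t : ℝ} (ht : 0 < t) (y : ℝ) :
    HasSum (fun j : ℕ => ‖Complex.exp (-(t + y * Complex.I))‖ ^ (2 * j + 1) -
      (Complex.exp (-(t + y * Complex.I)) ^ (2 * j + 1)).re) (1 / 2 * arcGap t y) := by
  have h1 := Complex.hasSum_re (hasSum_exp_odd (τ := t + y * Complex.I) (by simpa using ht))
  have h2 := Complex.hasSum_re (hasSum_exp_odd (τ := t) (by simpa using ht))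
  have h3 := h2.sub h1
  convert! h3 using 1
  · ext j
    congr 1
    rw [Complex.norm_exp, ← Complex.ofReal_neg, ← Complex.ofReal_exp, ← Complex.ofReal_pow,
      Complex.ofReal_re]
    simp
  · rw [← Complex.ofReal_sinh, arcGap, ← re_sinh, ← normSq_sinh]
    rw [one_div (2 * _), one_div (2 * Complex.sinh _), mul_inv, mul_inv, ← Complex.ofReal_inv]
    have : (2 : ℂ)⁻¹ = ((1 / 2 : ℝ) : ℂ) := by push_cast; ring
    rw [this, Complex.re_ofReal_mul, Complex.re_ofReal_mul, Complex.ofReal_re, Complex.inv_re]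
    ring

lemma norm_exp_neg_add (t y : ℝ) :
    ‖Complex.exp (-(t + y * Complex.I))‖ = Real.exp (-t) := by
  rw [Complex.norm_exp]; simp

lemma norm_oddPartGF_sq_le {t : ℝ} (ht : 0 < t) (y : ℝ) :
    ‖oddPartGF (Complex.exp (-(t + y * Complex.I)))‖ ^ 2 ≤
      ‖oddPartGF (Complex.exp (-(t : ℂ)))‖ ^ 2 * Real.exp (-(1 / 5 * arcGap t y)) := by
  have hq : ‖Complex.exp (-(t + y * Complex.I))‖ < 1 := norm_exp_neg_lt_one (by simpa using ht)
  have hr : ‖Complex.exp (-(t : ℂ))‖ < 1 := norm_exp_neg_lt_one (by simpa using ht)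
  refine le_of_tendsto_of_tendsto' ((tendsto_oddProd hq).norm.pow 2)
    (((tendsto_oddProd hr).norm.pow 2).mul
      ((Real.continuous_exp.tendsto _).comp
        (((hasSum_arcGap ht y).tendsto_sum_nat.const_mul (2 / 5)).neg))) ?_ |>.trans_eq ?_
  · intro m
    refine (norm_oddProd_sq_le hq m).trans_eq ?_
    rw [Function.comp_apply]
    congr 1
    rw [norm_exp_neg_add, ← Complex.ofReal_neg, ← Complex.ofReal_exp, ← ofReal_oddProd,
      Complex.norm_real, Real.norm_eq_abs, sq_abs]
  · congr 2; ring

lemma sinh_le_two_mul {t : ℝ} (h0 : 0 ≤ t) (h1 : t ≤ 1) : Real.sinh t ≤ 2 * t := by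
  have ha : |t| ≤ 1 := by rwa [abs_of_nonneg h0]
  have h2 := (abs_le.mp (Real.abs_exp_sub_one_sub_id_le ha)).2
  have h3 := Real.add_one_le_exp (-t)
  rw [Real.sinh_eq]
  nlinarith

/-- Supplies the integrable majorant on the full circle, uniformly in w. Either the gap D is at
least of order u², or D is at least of order 1/w², and then |w³u| ≤ π bounds u² by a multiple of D³.
-/
lemma one_add_sq_le_exp_arcGap : ∃ C : ℝ, 0 < C ∧ ∀ w u : ℝ, 0 < w → w ≤ 1 →
    |w ^ 3 * u| ≤ Real.pi → 1 + u ^ 2 ≤ C * Real.exp (1 / 5 * arcGap (w ^ 2) (w ^ 3 * u)) := by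
  have hpi := Real.pi_pos
  -- From u² ≤ 4π² D + 64π² D³ together with D ≤ 5 exp(D/5) and D³ ≤ 5³ · 3! exp(D/5).
  refine ⟨1 + 5 * (4 * Real.pi ^ 2) + 750 * (64 * Real.pi ^ 2), by positivity, ?_⟩
  intro w u hw hw1 hy
  set s := Real.sinh (w ^ 2) with hs
  set y := w ^ 3 * u with hydef
  set D := arcGap (w ^ 2) y with hD
  have hs0 : 0 < s := Real.sinh_pos_iff.mpr (by positivity)
  have hs2 : s ≤ 2 * w ^ 2 := sinh_le_two_mul (by positivity) (by nlinarith)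
  have hDeq : D = (s ^ 2 * (1 - Real.cos y) + Real.sin y ^ 2) /
      (s * (s ^ 2 + Real.sin y ^ 2)) := by
    rw [hD, arcGap, ← hs]
    field_simp
    ring
  have hcos := Real.cos_le_one y
  have hsin := sq_nonneg (Real.sin y)
  -- The first alternative occurs when |y| ≤ π/2 and |sin y| ≤ s, by Jordan's inequality; otherwise
  -- sin² y ≥ s² or cos y ≤ 0 gives the second.
  have hcase : u ^ 2 ≤ 4 * Real.pi ^ 2 * D ∨ 1 / (2 * s) ≤ D := by
    rcases le_total |y| (Real.pi / 2) with hle | hge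
    · have hsin2 : (2 / Real.pi * |y|) ^ 2 ≤ Real.sin y ^ 2 := by
        have h1 := Real.mul_le_sin (abs_nonneg y) hle
        have h2 : Real.sin |y| ^ 2 = Real.sin y ^ 2 := by
          rcases abs_choice y with h | h <;> rw [h]
          rw [Real.sin_neg, neg_sq]
        rw [← h2]
        exact pow_le_pow_left₀ (by positivity) h1 2
      rcases le_total (Real.sin y ^ 2) (s ^ 2) with hss | hss
      · left
        have h3 : Real.sin y ^ 2 / (2 * s ^ 3) ≤ D := by
          rw [hDeq, div_le_div_iff₀ (by positivity) (by positivity)]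
          have : 0 ≤ s ^ 2 * (1 - Real.cos y) := mul_nonneg (by positivity) (by linarith)
          nlinarith [mul_nonneg hs0.le (mul_nonneg hsin (sub_nonneg.mpr hss)),
            mul_nonneg this (by positivity : 0 ≤ s ^ 3)]
        have h4 : (2 / Real.pi * |y|) ^ 2 = 4 / Real.pi ^ 2 * (w ^ 6 * u ^ 2) := by
          rw [mul_pow, sq_abs, hydef]; ring
        have h5 : s ^ 3 ≤ (2 * w ^ 2) ^ 3 := pow_le_pow_left₀ hs0.le hs2 3
        have h6 : 4 / Real.pi ^ 2 * (w ^ 6 * u ^ 2) / (2 * (2 * w ^ 2) ^ 3) ≤ D := by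
          refine le_trans ?_ h3
          rw [← h4]
          gcongr
        calc u ^ 2 = 4 * Real.pi ^ 2 * (4 / Real.pi ^ 2 * (w ^ 6 * u ^ 2) / (2 * (2 * w ^ 2) ^ 3)) := by
              field_simp; ring
          _ ≤ _ := by gcongr
      · right
        rw [hDeq, div_le_div_iff₀ (by positivity) (by positivity)]
        have : 0 ≤ s ^ 2 * (1 - Real.cos y) := mul_nonneg (by positivity) (by linarith)
        nlinarith [mul_nonneg hs0.le (sub_nonneg.mpr hss), mul_nonneg this hs0.le]
    · right
      have hc : Real.cos y ≤ 0 := by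
        rw [← Real.cos_abs]
        exact Real.cos_nonpos_of_pi_div_two_le_of_le hge (by linarith)
      rw [hDeq, div_le_div_iff₀ (by positivity) (by positivity)]
      nlinarith [mul_nonneg (by positivity : 0 ≤ s ^ 3) (neg_nonneg.mpr hc),
        mul_nonneg hs0.le hsin, pow_pos hs0 3]
  have hD0 : 0 ≤ D := by
    rcases hcase with h | h
    · by_contra hneg
      push Not at hneg
      nlinarith [sq_nonneg u, mul_pos (by positivity : 0 < 4 * Real.pi ^ 2) (neg_pos.mpr hneg)]
    · exact le_trans (by positivity) h
  have hu : u ^ 2 ≤ 4 * Real.pi ^ 2 * D + 64 * Real.pi ^ 2 * D ^ 3 := by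
    rcases hcase with h | h
    · have : 0 ≤ 64 * Real.pi ^ 2 * D ^ 3 := by positivity
      linarith
    · have h1 : 1 / (4 * w ^ 2) ≤ D := by
        refine le_trans ?_ h
        exact one_div_le_one_div_of_le (by positivity) (by linarith)
      have h2 : (1 / (4 * w ^ 2)) ^ 3 ≤ D ^ 3 := pow_le_pow_left₀ (by positivity) h1 3
      have h3 : y ^ 2 ≤ Real.pi ^ 2 := sq_le_sq' (by linarith [abs_le.mp hy]) (abs_le.mp hy).2
      have h4 : u ^ 2 = y ^ 2 / w ^ 6 := by rw [hydef]; field_simp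
      have h5 : u ^ 2 ≤ 64 * Real.pi ^ 2 * (1 / (4 * w ^ 2)) ^ 3 := by
        rw [h4]
        calc y ^ 2 / w ^ 6 ≤ Real.pi ^ 2 / w ^ 6 := by gcongr
          _ = _ := by field_simp; norm_num
      have : 64 * Real.pi ^ 2 * (1 / (4 * w ^ 2)) ^ 3 ≤ 64 * Real.pi ^ 2 * D ^ 3 := by gcongr
      have : 0 ≤ 4 * Real.pi ^ 2 * D := by positivity
      linarith
  have hx : 0 ≤ 1 / 5 * D := by positivity
  have e0 : 1 ≤ Real.exp (1 / 5 * D) := Real.one_le_exp hx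
  have e1 : 1 / 5 * D ≤ Real.exp (1 / 5 * D) := by
    have := Real.add_one_le_exp (1 / 5 * D); linarith
  have e3 := Real.pow_div_factorial_le_exp (1 / 5 * D) hx 3
  norm_num [Nat.factorial] at e3
  have f1 : D ≤ 5 * Real.exp (1 / 5 * D) := by linarith
  have f3 : D ^ 3 ≤ 750 * Real.exp (1 / 5 * D) := by nlinarith
  calc 1 + u ^ 2 ≤ 1 + 4 * Real.pi ^ 2 * D + 64 * Real.pi ^ 2 * D ^ 3 := by linarith
    _ ≤ Real.exp (1 / 5 * D) + 4 * Real.pi ^ 2 * (5 * Real.exp (1 / 5 * D)) +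
        64 * Real.pi ^ 2 * (750 * Real.exp (1 / 5 * D)) := by gcongr
    _ = _ := by ring

/-! ### Cauchy's coefficient formula -/

lemma integral_exp_int_mul_I (k : ℤ) :
    ∫ y in (-Real.pi)..Real.pi, Complex.exp ((k : ℂ) * Complex.I * y) =
      if k = 0 then 2 * (Real.pi : ℂ) else 0 := by
  split_ifs with hk
  · subst hk
    simp
    ring
  · have hc : (k : ℂ) * Complex.I ≠ 0 := mul_ne_zero (by exact_mod_cast hk) Complex.I_ne_zero
    rw [integral_exp_mul_complex hc]
    have : Complex.exp ((k : ℂ) * Complex.I * Real.pi) =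
        Complex.exp ((k : ℂ) * Complex.I * (-Real.pi : ℝ)) := by
      rw [Complex.exp_eq_exp_iff_exists_int]
      exact ⟨k, by push_cast; ring⟩
    rw [this, sub_self, zero_div]

/-- Cauchy's formula for the coefficients of a power series that converges in the unit disc. -/
lemma integral_powerSeries_coeff {c : ℕ → ℝ} {f : ℂ → ℂ}
    (hf : ∀ q : ℂ, ‖q‖ < 1 → HasSum (fun n => (c n : ℂ) * q ^ n) (f q))
    {t : ℝ} (ht : 0 < t) (n : ℕ) :
    ∫ y in (-Real.pi)..Real.pi,
        f (Complex.exp (-(t + y * Complex.I))) * Complex.exp (n * Complex.I * y) =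
      2 * Real.pi * (c n * Real.exp (-(n * t))) := by
  have hsum : Summable fun m => |c m| * Real.exp (-(m * t)) := by
    have h := (hf (Complex.exp (-(t : ℂ))) (norm_exp_neg_lt_one (by simpa using ht))).summable.norm
    refine h.congr fun m => ?_
    rw [norm_mul, norm_pow, Complex.norm_real, Real.norm_eq_abs, Complex.norm_exp,
      ← Real.exp_nat_mul]
    simp
  have hterm : ∀ (m : ℕ) (y : ℝ),
      (c m : ℂ) * Complex.exp (-(t + y * Complex.I)) ^ m * Complex.exp (n * Complex.I * y) =
        (c m * Real.exp (-(m * t)) : ℝ) *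
          Complex.exp (((n - m : ℤ) : ℂ) * Complex.I * y) := by
    intro m y
    rw [← Complex.exp_nat_mul]
    push_cast
    rw [mul_assoc (c m : ℂ), mul_assoc (c m : ℂ), ← Complex.exp_add, ← Complex.exp_add]
    congr 2
    ring
  have h := intervalIntegral.hasSum_integral_of_dominated_convergence
    (μ := MeasureTheory.volume) (a := -Real.pi) (b := Real.pi)
    (F := fun m y => ((c m * Real.exp (-(m * t)) : ℝ) : ℂ) *
          Complex.exp (((n - m : ℤ) : ℂ) * Complex.I * y))
    (f := fun y => f (Complex.exp (-(t + y * Complex.I))) * Complex.exp (n * Complex.I * y))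
    (fun m _ => |c m| * Real.exp (-(m * t)))
    (fun m => (Continuous.aestronglyMeasurable (by fun_prop)))
    (fun m => .of_forall fun y _ => by
      rw [norm_mul, Complex.norm_exp, Complex.norm_real, Real.norm_eq_abs, abs_mul, Real.abs_exp]
      simp)
    (.of_forall fun y _ => hsum) (by simp)
    (.of_forall fun y _ => by
      have := (hf (Complex.exp (-(t + y * Complex.I)))
        (norm_exp_neg_lt_one (by simpa using ht))).mul_right (Complex.exp (n * Complex.I * y))
      simpa only [hterm] using this)
  have h2 := hasSum_ite_eq n (2 * (Real.pi : ℂ) * (c n * Real.exp (-(n * t))))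
  refine h.unique ?_
  convert! h2 using 2 with m
  rw [intervalIntegral.integral_const_mul, integral_exp_int_mul_I]
  by_cases hm : m = n
  · subst hm; simp; ring
  · have : (n : ℤ) - m ≠ 0 := by omega
    simp [hm, this]

/-! ### Saddle point and circle method -/

/-- For τ = w²(1 + iuw), the linear term of A/τ = (A/w²)(1 - iuw - u²w² + ...) is cancelled by the
oscillating factor and the constant term by the last factor; the quadratic term is the Gaussian. -/
lemma tendsto_saddle_point (u : ℝ) :
    Tendsto (fun w : ℝ => oddPartGF (Complex.exp (-((w ^ 2 : ℝ) + (w ^ 3 * u : ℝ) * Complex.I))) ^ 2 *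
        Complex.exp ((Real.pi ^ 2 / 6 / w ^ 4 : ℝ) * Complex.I * (w ^ 3 * u : ℝ)) *
        Complex.exp (-(Real.pi ^ 2 / 6 / w ^ 2 : ℝ)))
      (𝓝[>] 0) (𝓝 ((1 / 2 * Real.exp (-(Real.pi ^ 2 / 6) * u ^ 2) : ℝ) : ℂ)) := by
  have hpos : ∀ᶠ w : ℝ in 𝓝[>] 0, 0 < w := eventually_mem_nhdsWithin
  have hw : Tendsto (fun w : ℝ => w) (𝓝[>] 0) (𝓝 0) := tendsto_nhdsWithin_of_tendsto_nhds tendsto_id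
  have hwc : Tendsto (fun w : ℝ => (w : ℂ)) (𝓝[>] 0) (𝓝 0) := by
    simpa [Function.comp_def] using (Complex.continuous_ofReal.tendsto 0).comp hw
  have hinv : ∀ w : ℝ, 0 < w →
      (((w ^ 2 : ℝ) : ℂ) + (w ^ 3 * u : ℝ) * Complex.I)⁻¹.re = (w⁻¹) ^ 2 * (1 + w ^ 2 * u ^ 2)⁻¹ := by
    intro w hw
    rw [Complex.inv_re, Complex.normSq_add_mul_I]
    simp only [Complex.add_re, Complex.ofReal_re, Complex.mul_re, Complex.I_re, Complex.ofReal_im,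
      Complex.I_im, mul_zero, zero_mul, sub_zero, add_zero]
    field_simp
  have hR := tendsto_eulerPhi_quotient (l := 𝓝[>] (0 : ℝ))
    (τ := fun w : ℝ => ((w ^ 2 : ℝ) : ℂ) + (w ^ 3 * u : ℝ) * Complex.I) (by
      refine Tendsto.congr' (hpos.mono fun w hw => (hinv w hw).symm) ?_
      have h1 : Tendsto (fun w : ℝ => (w⁻¹) ^ 2) (𝓝[>] 0) atTop :=
        (tendsto_pow_atTop two_ne_zero).comp tendsto_inv_nhdsGT_zero
      refine h1.atTop_mul_pos (C := 1) one_pos ?_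
      have : Tendsto (fun w : ℝ => (1 + w ^ 2 * u ^ 2)⁻¹) (𝓝[>] 0) (𝓝 ((1 + 0 ^ 2 * u ^ 2)⁻¹)) :=
        ((hw.pow 2).mul_const _).const_add 1 |>.inv₀ (by norm_num)
      simpa using this)
  have hE : Tendsto (fun w : ℝ => Complex.exp (((w : ℂ) ^ 2 + (w : ℂ) ^ 3 * u * Complex.I) / 12 -
      Real.pi ^ 2 / 6 * u ^ 2 / (1 + Complex.I * u * w))) (𝓝[>] 0)
      (𝓝 (Complex.exp (((0 : ℂ) ^ 2 + (0 : ℂ) ^ 3 * u * Complex.I) / 12 -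
      Real.pi ^ 2 / 6 * u ^ 2 / (1 + Complex.I * u * 0)))) := by
    refine (Complex.continuous_exp.tendsto _).comp (Tendsto.sub ?_ ?_)
    · exact ((hwc.pow 2).add (((hwc.pow 3).mul_const _).mul_const _)).div_const _
    · exact tendsto_const_nhds.div ((hwc.const_mul _).const_add 1) (by simp)
  have h := (hE.const_mul (1 / 2 : ℂ)).mul hR
  convert! h.congr' ?_ using 2
  · push_cast
    simp
  filter_upwards [hpos] with w hw
  have hw0 : (w : ℂ) ≠ 0 := by exact_mod_cast hw.ne'
  have h1 : (1 : ℂ) + Complex.I * u * w ≠ 0 := by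
    intro h
    have := congrArg Complex.re h
    simp at this
  have hτ : 0 < (((w ^ 2 : ℝ) : ℂ) + (w ^ 3 * u : ℝ) * Complex.I).re := by
    simp only [Complex.add_re, Complex.ofReal_re, Complex.mul_re, Complex.I_re, Complex.ofReal_im,
      Complex.I_im, mul_zero, zero_mul, sub_zero, add_zero]
    positivity
  have h2 : ((w ^ 2 : ℝ) : ℂ) + (w ^ 3 * u : ℝ) * Complex.I =
      w ^ 2 * (1 + Complex.I * u * w) := by push_cast; ring
  rw [oddPartGF_exp_sq hτ]
  generalize (eulerPhi _ / eulerPhi _) ^ 2 = R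
  have key : Complex.exp (((w : ℂ) ^ 2 + (w : ℂ) ^ 3 * u * Complex.I) / 12 -
      Real.pi ^ 2 / 6 * u ^ 2 / (1 + Complex.I * u * w)) =
      Complex.exp ((((w ^ 2 : ℝ) : ℂ) + (w ^ 3 * u : ℝ) * Complex.I) / 12 +
        Real.pi ^ 2 / (6 * (((w ^ 2 : ℝ) : ℂ) + (w ^ 3 * u : ℝ) * Complex.I))) *
      Complex.exp ((Real.pi ^ 2 / 6 / w ^ 4 : ℝ) * Complex.I * (w ^ 3 * u : ℝ)) *
      Complex.exp (-(Real.pi ^ 2 / 6 / w ^ 2 : ℝ)) := by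
    rw [← Complex.exp_add, ← Complex.exp_add, h2]
    congr 1
    push_cast
    -- Expressing u through v = 1 + iuw makes the exponents rational in v and w.
    have hu : (u : ℂ) = -(1 + Complex.I * u * w - 1) * Complex.I / w := by
      field_simp
      linear_combination ((u : ℂ) * w) * Complex.I_sq
    generalize (1 : ℂ) + Complex.I * u * w = v at *
    rw [hu]
    field_simp
    ring_nf
    simp only [Complex.I_sq]
    ring
  rw [key]
  ring

lemma norm_exp_neg_ofReal (x : ℝ) : ‖Complex.exp (-(x : ℂ))‖ = Real.exp (-x) := by
  rw [Complex.norm_exp, Complex.neg_re, Complex.ofReal_re]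

lemma norm_exp_ofReal_mul_I_mul (a y : ℝ) : ‖Complex.exp (a * Complex.I * y)‖ = 1 := by
  rw [Complex.norm_exp]; simp

/-- The scale `(π² / (6 n)) ^ (1/4)` of the saddle point. -/
noncomputable def saddle (n : ℕ) : ℝ := √√(Real.pi ^ 2 / 6 / n)

lemma saddle_pos {n : ℕ} (hn : 0 < n) : 0 < saddle n := by
  have : (0 : ℝ) < n := by exact_mod_cast hn
  unfold saddle
  have := Real.pi_pos
  positivity

lemma saddle_sq (n : ℕ) : saddle n ^ 2 = √(Real.pi ^ 2 / 6 / n) :=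
  Real.sq_sqrt (Real.sqrt_nonneg _)

lemma saddle_pow_four (n : ℕ) : saddle n ^ 4 = Real.pi ^ 2 / 6 / n := by
  rw [show saddle n ^ 4 = (saddle n ^ 2) ^ 2 by ring, saddle_sq, Real.sq_sqrt (by positivity)]

lemma natCast_mul_saddle_sq {n : ℕ} (hn : 0 < n) :
    n * saddle n ^ 2 = Real.pi ^ 2 / 6 / saddle n ^ 2 := by
  have h := saddle_pow_four n
  have h0 := saddle_pos hn
  have hn' : (0 : ℝ) < n := by exact_mod_cast hn
  rw [eq_div_iff hn'.ne'] at h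
  rw [eq_div_iff (by positivity), ← h]
  ring

lemma tendsto_saddle : Tendsto saddle atTop (𝓝[>] 0) := by
  refine tendsto_nhdsWithin_iff.mpr ⟨?_, ?_⟩
  · have h : Tendsto (fun n : ℕ => √√(Real.pi ^ 2 / 6 / n)) atTop (𝓝 √√0) :=
      (Real.continuous_sqrt.comp Real.continuous_sqrt).tendsto 0 |>.comp
        (tendsto_const_div_atTop_nhds_zero_nat _)
    simp only [Real.sqrt_zero] at h
    exact h
  · filter_upwards [eventually_gt_atTop 0] with n hn using saddle_pos hn

lemma tendsto_norm_oddPartGF_sq :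
    Tendsto (fun w : ℝ => ‖oddPartGF (Complex.exp (-((w ^ 2 : ℝ) : ℂ)))‖ ^ 2 *
      Real.exp (-(Real.pi ^ 2 / 6 / w ^ 2))) (𝓝[>] 0) (𝓝 (1 / 2)) := by
  have h := (tendsto_saddle_point 0).norm
  rw [Complex.norm_real] at h
  have h2 : ‖(1 / 2 * Real.exp (-(Real.pi ^ 2 / 6) * 0 ^ 2) : ℝ)‖ = 1 / 2 := by simp
  rw [h2] at h
  refine h.congr fun w => ?_
  rw [norm_mul, norm_mul, norm_pow, norm_exp_neg_ofReal, norm_exp_ofReal_mul_I_mul]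
  simp

/-- Measurability passes to the pointwise limit of the finite products. -/
lemma measurable_oddPartGF_exp {t : ℝ} (ht : 0 < t) :
    Measurable fun y : ℝ => oddPartGF (Complex.exp (-(t + y * Complex.I))) := by
  refine measurable_of_tendsto_metrizable (f := fun m (y : ℝ) =>
    oddProd (Complex.exp (-(t + y * Complex.I))) m) (fun m => ?_) ?_
  · unfold oddProd
    fun_prop
  · exact tendsto_pi_nhds.mpr fun y => tendsto_oddProd (norm_exp_neg_lt_one (by simpa using ht))

/-- The circle method: asymptotics of the coefficients of the square of `oddPartGF`. -/
lemma tendsto_coeff_oddPartGF_sq {c : ℕ → ℝ}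
    (hc : ∀ q : ℂ, ‖q‖ < 1 → HasSum (fun n => (c n : ℂ) * q ^ n) (oddPartGF q ^ 2)) :
    Tendsto (fun n => c n * Real.exp (-(2 * (Real.pi ^ 2 / 6) / saddle n ^ 2)) / saddle n ^ 3) atTop
      (𝓝 (√(Real.pi / (Real.pi ^ 2 / 6)) / (4 * Real.pi))) := by
  have hpi := Real.pi_pos
  set A := Real.pi ^ 2 / 6 with hA
  set g : ℕ → ℝ → ℂ := fun n => Set.indicator (Set.Ioc (-Real.pi) Real.pi) fun y =>
    oddPartGF (Complex.exp (-((saddle n ^ 2 : ℝ) + y * Complex.I))) ^ 2 *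
      Complex.exp (n * Complex.I * y) with hg
  set G : ℕ → ℝ → ℂ := fun n u =>
    g n (saddle n ^ 3 * u) * Complex.exp (-(A / saddle n ^ 2 : ℝ)) with hG
  obtain ⟨C, hC0, hC⟩ := one_add_sq_le_exp_arcGap
  have hlim : Tendsto (fun n => ∫ u, G n u) atTop
      (𝓝 (∫ u : ℝ, ((1 / 2 * Real.exp (-A * u ^ 2) : ℝ) : ℂ))) := by
    refine MeasureTheory.tendsto_integral_filter_of_dominated_convergence
      (fun u => C * (1 + u ^ 2)⁻¹) ?_ ?_ (integrable_inv_one_add_sq.const_mul C) ?_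
    · filter_upwards [eventually_gt_atTop 0] with n hn
      have hm := measurable_oddPartGF_exp (pow_pos (saddle_pos hn) 2)
      have hg' : Measurable (g n) :=
        ((hm.pow_const 2).mul (by fun_prop)).indicator measurableSet_Ioc
      exact ((hg'.comp (measurable_const_mul _)).mul_const _).aestronglyMeasurable
    · have h1 : ∀ᶠ w : ℝ in 𝓝[>] 0, ‖oddPartGF (Complex.exp (-((w ^ 2 : ℝ) : ℂ)))‖ ^ 2 *
          Real.exp (-(A / w ^ 2)) ≤ 1 :=
        (tendsto_norm_oddPartGF_sq.eventually_lt_const (by norm_num : (1 / 2 : ℝ) < 1)).mono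
          fun _ h => h.le
      have h2 : ∀ᶠ w : ℝ in 𝓝[>] 0, w ≤ 1 :=
        (eventually_le_nhds (by norm_num : (0 : ℝ) < 1)).filter_mono nhdsWithin_le_nhds
      filter_upwards [eventually_gt_atTop 0, tendsto_saddle.eventually h1,
        tendsto_saddle.eventually h2] with n hn h1 h2
      refine .of_forall fun u => ?_
      have hw := saddle_pos hn
      by_cases hu : saddle n ^ 3 * u ∈ Set.Ioc (-Real.pi) Real.pi
      · have hb := norm_oddPartGF_sq_le (pow_pos hw 2) (saddle n ^ 3 * u)
        have hD := hC (saddle n) u hw h2 (abs_le.mpr ⟨hu.1.le, hu.2⟩)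
        have hGn : ‖G n u‖ = ‖oddPartGF (Complex.exp (-((saddle n ^ 2 : ℝ) +
            (saddle n ^ 3 * u : ℝ) * Complex.I)))‖ ^ 2 * Real.exp (-(A / saddle n ^ 2)) := by
          simp only [hG, hg]
          rw [Set.indicator_of_mem hu, norm_mul, norm_mul, norm_pow, norm_exp_neg_ofReal,
            ← Complex.ofReal_natCast n, norm_exp_ofReal_mul_I_mul, mul_one]
        rw [hGn]
        have hD' : Real.exp (-(1 / 5 * arcGap (saddle n ^ 2) (saddle n ^ 3 * u))) ≤
            C * (1 + u ^ 2)⁻¹ := by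
          rw [Real.exp_neg, ← div_eq_mul_inv, inv_le_comm₀ (Real.exp_pos _) (by positivity),
            inv_div, div_le_iff₀ hC0]
          linarith
        calc _ ≤ _ := mul_le_mul_of_nonneg_right hb (Real.exp_pos _).le
          _ = ‖oddPartGF (Complex.exp (-((saddle n ^ 2 : ℝ) : ℂ)))‖ ^ 2 *
              Real.exp (-(A / saddle n ^ 2)) *
              Real.exp (-(1 / 5 * arcGap (saddle n ^ 2) (saddle n ^ 3 * u))) := by ring
          _ ≤ 1 * (C * (1 + u ^ 2)⁻¹) := by gcongr
          _ = _ := one_mul _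
      · simp only [hG, hg]
        rw [Set.indicator_of_notMem hu, zero_mul, norm_zero]
        positivity
    · refine .of_forall fun u => ?_
      have h := (tendsto_saddle_point u).comp tendsto_saddle
      refine h.congr' ?_
      have h3 : Tendsto (fun n => saddle n ^ 3 * u) atTop (𝓝 0) := by
        have := ((tendsto_nhds_of_tendsto_nhdsWithin tendsto_saddle).pow 3).mul_const u
        simpa using this
      -- For fixed u the point w³u eventually lies in the integration interval, so the indicator
      -- disappears; moreover A/w⁴ = n.
      filter_upwards [eventually_gt_atTop 0,
        h3.eventually (Ioc_mem_nhds (neg_lt_zero.mpr hpi) hpi)] with n hn hu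
      simp only [hG, hg, Function.comp_apply]
      rw [Set.indicator_of_mem (s := Set.Ioc (-Real.pi) Real.pi) hu]
      congr 3
      have hn' : (n : ℝ) ≠ 0 := by exact_mod_cast hn.ne'
      rw [saddle_pow_four, div_div_cancel₀ (by positivity)]
      simp
  have hval : ∀ᶠ n in atTop, ∫ u, G n u =
      ((2 * Real.pi * (c n * Real.exp (-(2 * A / saddle n ^ 2)) / saddle n ^ 3) : ℝ) : ℂ) := by
    filter_upwards [eventually_gt_atTop 0] with n hn
    have hw := saddle_pos hn
    simp only [hG]
    -- The substitution y = w³u produces w⁻³, and n w² = A/w² makes both exponential factors equal.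
    rw [MeasureTheory.integral_mul_const, MeasureTheory.Measure.integral_comp_mul_left (g n),
      MeasureTheory.integral_indicator measurableSet_Ioc,
      ← intervalIntegral.integral_of_le (by linarith),
      integral_powerSeries_coeff hc (pow_pos hw 2) n, natCast_mul_saddle_sq hn, ← hA,
      abs_of_pos (by positivity), Complex.real_smul]
    have : Real.exp (-(2 * A / saddle n ^ 2)) =
        Real.exp (-(A / saddle n ^ 2)) * Real.exp (-(A / saddle n ^ 2)) := by
      rw [← Real.exp_add]; congr 1; ring
    rw [this, ← Complex.ofReal_neg, ← Complex.ofReal_exp]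
    push_cast
    ring
  have h := Complex.continuous_re.tendsto _ |>.comp (hlim.congr' hval)
  rw [integral_complex_ofReal, Complex.ofReal_re, MeasureTheory.integral_const_mul,
    integral_gaussian] at h
  have h' := h.div_const (2 * Real.pi)
  convert! h' using 2
  · simp only [Function.comp_apply, Complex.ofReal_re]
    field_simp
  · ring

/-! ### Generating functions of lists of odd parts -/

lemma hasSum_mul_prod {ι κ : Type*} {f : ι → ℂ} {g : κ → ℂ} {s t : ℂ} (hf : HasSum f s)
    (hg : HasSum g t) : HasSum (fun p : ι × κ => f p.1 * g p.2) (s * t) :=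
  hf.mul hg (summable_mul_of_summable_norm hf.summable.norm hg.summable.norm)

/-- Partitions into odd parts less than `2 m`, as weakly increasing lists. -/
def OddLists (m : ℕ) : Type := {l : List ℕ // l.Pairwise (· ≤ ·) ∧ ∀ x ∈ l, Odd x ∧ x < 2 * m}

namespace OddLists

lemma eq_append_replicate {m : ℕ} {l : List ℕ} (hs : l.Pairwise (· ≤ ·))
    (hl : ∀ x ∈ l, Odd x ∧ x < 2 * (m + 1)) :
    ∃ (l' : OddLists m) (k : ℕ), l = l'.1 ++ List.replicate k (2 * m + 1) := by
  induction l with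
  | nil => exact ⟨⟨[], by simp⟩, 0, by simp⟩
  | cons x l ih =>
    rw [List.pairwise_cons] at hs
    obtain ⟨l', k, rfl⟩ := ih hs.2 fun y hy => hl y (List.mem_cons_of_mem _ hy)
    have hx := hl x List.mem_cons_self
    by_cases hxm : x < 2 * m
    · refine ⟨⟨x :: l'.1, List.pairwise_cons.mpr
        ⟨fun y hy => hs.1 y (List.mem_append_left _ hy), l'.2.1⟩, ?_⟩, k, rfl⟩
      intro y hy
      rcases List.mem_cons.mp hy with rfl | hy
      · exact ⟨hx.1, hxm⟩
      · exact l'.2.2 y hy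
    · have hx1 : x = 2 * m + 1 := by
        obtain ⟨⟨j, rfl⟩, h⟩ := hx
        omega
      -- A head equal to the largest allowed part leaves no room for smaller parts after it.
      have hnil : l'.1 = [] := by
        refine List.eq_nil_iff_forall_not_mem.mpr fun y hy => ?_
        have h1 := hs.1 y (List.mem_append_left _ hy)
        have h2 := (l'.2.2 y hy).2
        omega
      exact ⟨⟨[], by simp⟩, k + 1, by rw [hnil, hx1]; rfl⟩

/-- Appending `k` copies of the part `2 m + 1`. -/
def append (m : ℕ) (p : OddLists m × ℕ) : OddLists (m + 1) :=
  ⟨p.1.1 ++ List.replicate p.2 (2 * m + 1), by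
    refine List.pairwise_append.mpr ⟨p.1.2.1, List.pairwise_replicate_of_refl, ?_⟩
    intro x hx y hy
    rw [List.eq_of_mem_replicate hy]
    have := (p.1.2.2 x hx).2
    omega, by
    intro x hx
    rcases List.mem_append.mp hx with hx | hx
    · have := p.1.2.2 x hx
      exact ⟨this.1, by omega⟩
    · rw [List.eq_of_mem_replicate hx]
      exact ⟨⟨m, rfl⟩, by omega⟩⟩

lemma append_bijective (m : ℕ) : Function.Bijective (append m) := by
  constructor
  · rintro ⟨l, k⟩ ⟨l', k'⟩ h
    have h0 : l.1 ++ List.replicate k (2 * m + 1) = l'.1 ++ List.replicate k' (2 * m + 1) :=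
      congrArg Subtype.val h
    have hnot : ∀ l : OddLists m, l.1.count (2 * m + 1) = 0 := fun l =>
      List.count_eq_zero_of_not_mem fun hmem => by have := (l.2.2 _ hmem).2; omega
    have h1 := congrArg (List.count (2 * m + 1)) h0
    simp only [List.count_append, hnot, List.count_replicate_self, zero_add] at h1
    subst h1
    have h2 : l = l' := Subtype.ext (List.append_cancel_right h0)
    rw [h2]
  · rintro ⟨l, hs, hl⟩
    obtain ⟨l', k, h⟩ := eq_append_replicate hs hl
    exact ⟨(l', k), Subtype.ext h.symm⟩

lemma sum_append (m : ℕ) (p : OddLists m × ℕ) :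
    (append m p).1.sum = p.1.1.sum + p.2 * (2 * m + 1) := by
  simp [append]

lemma mem_append_iff (m : ℕ) (p : OddLists m × ℕ) :
    2 * m + 1 ∈ (append m p).1 ↔ p.2 ≠ 0 := by
  have : 2 * m + 1 ∉ p.1.1 := fun hmem => by have := (p.1.2.2 _ hmem).2; omega
  simp [append, this]

lemma hasSum_pow_sum {q : ℂ} (hq : ‖q‖ < 1) (m : ℕ) :
    HasSum (fun l : OddLists m => q ^ l.1.sum) (oddProd q m) := by
  induction m with
  | zero =>
    have : ∀ l : OddLists 0, l = ⟨[], by simp⟩ := by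
      rintro ⟨l, hs, hl⟩
      refine Subtype.ext (List.eq_nil_iff_forall_not_mem.mpr fun y hy => ?_)
      have := (hl y hy).2
      omega
    have h := hasSum_single (f := fun l : OddLists 0 => q ^ l.1.sum) ⟨[], by simp⟩
      fun l hl => absurd (this l) hl
    simpa [oddProd] using h
  | succ m ih =>
    have hx : ‖q ^ (2 * m + 1)‖ < 1 := by
      rw [norm_pow]; exact pow_lt_one₀ (norm_nonneg _) hq (by omega)
    have hg := hasSum_geometric_of_norm_lt_one hx
    have h := hasSum_mul_prod ih hg
    rw [← (Equiv.ofBijective _ (append_bijective m)).hasSum_iff, oddProd_succ]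
    refine h.congr_fun fun p => ?_
    simp only [Function.comp_apply, Equiv.ofBijective_apply, sum_append]
    rw [pow_add, mul_comm p.2, pow_mul]

/-- The lists that avoid 2m+1 are exactly those with zero copies appended, and they contribute
`oddProd q m`. -/
lemma hasSum_pow_sum_of_mem {q : ℂ} (hq : ‖q‖ < 1) (m : ℕ) :
    HasSum (fun l : OddLists (m + 1) => if 2 * m + 1 ∈ l.1 then q ^ l.1.sum else 0)
      (oddProd q (m + 1) - oddProd q m) := by
  have h0 : HasSum (fun l : OddLists (m + 1) => if 2 * m + 1 ∈ l.1 then 0 else q ^ l.1.sum)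
      (oddProd q m) := by
    have hinj : Function.Injective fun l : OddLists m => append m (l, 0) := fun l l' h =>
      (Prod.mk.inj ((append_bijective m).1 h)).1
    rw [← hinj.hasSum_iff]
    · refine (hasSum_pow_sum hq m).congr_fun fun l => ?_
      simp [mem_append_iff, sum_append]
    · intro l hl
      obtain ⟨⟨l', k⟩, rfl⟩ := (append_bijective m).2 l
      by_cases hk : k = 0
      · subst hk
        exact absurd ⟨l', rfl⟩ hl
      · simp [mem_append_iff, hk]
  convert! (hasSum_pow_sum hq (m + 1)).sub h0 using 2 with l
  split_ifs <;> simp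

end OddLists

/-! ### Increments and monotonicity of the finite products -/

/-- This turns the weight of the peak into an increment, which is what makes the sum over peaks
telescope. -/
lemma oddProd_succ_sub {q : ℂ} (hq : ‖q‖ < 1) (m : ℕ) :
    oddProd q (m + 1) - oddProd q m = q ^ (2 * m + 1) * oddProd q (m + 1) := by
  have := one_sub_pow_ne_zero hq (2 * m)
  rw [oddProd_succ]
  field_simp
  ring

lemma oddProd_succ_sub_real {r : ℝ} (h0 : 0 ≤ r) (h1 : r < 1) (m : ℕ) :
    oddProd r (m + 1) - oddProd r m = r ^ (2 * m + 1) * oddProd r (m + 1) := by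
  have h := oddProd_succ_sub (q := (r : ℂ)) (by simpa [abs_of_nonneg h0] using h1) m
  simp only [← ofReal_oddProd] at h
  exact_mod_cast h

lemma oddProd_nonneg {r : ℝ} (h0 : 0 ≤ r) (h1 : r < 1) (m : ℕ) : 0 ≤ oddProd r m :=
  Finset.prod_nonneg fun _ _ => inv_nonneg.mpr (sub_nonneg.mpr (pow_le_one₀ h0 h1.le))

lemma oddProd_monotone {r : ℝ} (h0 : 0 ≤ r) (h1 : r < 1) : Monotone (oddProd r) := by
  refine monotone_nat_of_le_succ fun m => ?_
  have h := oddProd_succ_sub_real h0 h1 m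
  have := mul_nonneg (pow_nonneg h0 (2 * m + 1)) (oddProd_nonneg h0 h1 (m + 1))
  linarith

lemma tendsto_oddProd_real {r : ℝ} (h0 : 0 ≤ r) (h1 : r < 1) :
    Tendsto (oddProd r) atTop (𝓝 ‖oddPartGF r‖) := by
  have hr : ‖(r : ℂ)‖ < 1 := by simpa [abs_of_nonneg h0] using h1
  refine (tendsto_oddProd hr).norm.congr fun m => ?_
  rw [← ofReal_oddProd, Complex.norm_real, Real.norm_of_nonneg (oddProd_nonneg h0 h1 m)]

lemma oddProd_le {r : ℝ} (h0 : 0 ≤ r) (h1 : r < 1) (m : ℕ) : oddProd r m ≤ ‖oddPartGF r‖ :=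
  (oddProd_monotone h0 h1).ge_of_tendsto (tendsto_oddProd_real h0 h1) m

/-! ### Odd unimodal sequences sorted by peak -/

namespace UnimodalSeq

/-- The odd unimodal sequence with peak `2 m + 1` and the given sides, both listed in increasing
order. -/
def ofOddLists (x : Σ m : ℕ, OddLists (m + 1) × OddLists (m + 1)) : UnimodalSeq where
  left := x.2.1.1
  peak := 2 * x.1 + 1
  right := x.2.2.1.reverse
  pos := by
    intro y hy
    simp only [List.mem_append, List.mem_cons, List.mem_reverse] at hy
    rcases hy with hy | rfl | hy
    · exact (x.2.1.2.2 y hy).1.pos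
    · omega
    · exact (x.2.2.2.2 y hy).1.pos
  left_le := by
    refine List.pairwise_append.mpr ⟨x.2.1.2.1, List.pairwise_singleton _ _, fun y hy z hz => ?_⟩
    rw [List.mem_singleton.mp hz]
    have := (x.2.1.2.2 y hy).2
    omega
  right_ge := by
    refine List.pairwise_cons.mpr ⟨fun y hy => ?_, ?_⟩
    · have := (x.2.2.2.2 y (List.mem_reverse.mp hy)).2
      change y ≤ 2 * x.1 + 1
      omega
    · exact List.pairwise_reverse.mpr x.2.2.2.1

lemma ofOddLists_injective : Function.Injective ofOddLists := by
  rintro ⟨m, l, r⟩ ⟨m', l', r'⟩ h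
  have h1 : 2 * m + 1 = 2 * m' + 1 := congrArg UnimodalSeq.peak h
  obtain rfl : m = m' := by omega
  have h2 : l.1 = l'.1 := congrArg UnimodalSeq.left h
  have h3 : r.1.reverse = r'.1.reverse := congrArg UnimodalSeq.right h
  rw [Subtype.ext h2, Subtype.ext (List.reverse_injective h3)]

lemma weight_ofOddLists (x : Σ m : ℕ, OddLists (m + 1) × OddLists (m + 1)) :
    (ofOddLists x).weight = (2 * x.1 + 1) + (x.2.1.1.sum + x.2.2.1.sum) := by
  simp [weight, entries, ofOddLists]
  ring

lemma isOdd_ofOddLists (x : Σ m : ℕ, OddLists (m + 1) × OddLists (m + 1)) :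
    (ofOddLists x).IsOdd := by
  intro y hy
  simp only [entries, ofOddLists, List.mem_append, List.mem_cons, List.mem_reverse] at hy
  rcases hy with hy | rfl | hy
  · exact (x.2.1.2.2 y hy).1
  · exact ⟨_, rfl⟩
  · exact (x.2.2.2.2 y hy).1

lemma exists_ofOddLists_eq {u : UnimodalSeq} (hu : u.IsOdd) : ∃ x, ofOddLists x = u := by
  obtain ⟨m, hm⟩ : Odd u.peak := hu _ (by simp [entries])
  have hl := List.pairwise_append.mp u.left_le
  have hr := List.pairwise_cons.mp u.right_ge
  refine ⟨⟨m, ⟨u.left, hl.1, fun x hx => ⟨hu x (by simp [entries, hx]), ?_⟩⟩,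
    ⟨u.right.reverse, List.pairwise_reverse.mpr hr.2, fun x hx =>
      ⟨hu x (by rw [List.mem_reverse] at hx; simp [entries, hx]), ?_⟩⟩⟩, ?_⟩
  · have := hl.2.2 x hx u.peak (by simp)
    omega
  · have : x ≤ u.peak := hr.1 x (List.mem_reverse.mp hx)
    omega
  · ext1 <;> simp [ofOddLists, hm]

/-- From a sum over unimodal sequences to a power series. -/
lemma hasSum_ncard_mul_pow {S : Set UnimodalSeq} {q s : ℂ}
    (h : HasSum (S.indicator fun u => q ^ u.weight) s) :
    HasSum (fun n => ({u : UnimodalSeq | u ∈ S ∧ u.weight = n}.ncard : ℂ) * q ^ n) s := by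
  have h1 := (Equiv.sigmaFiberEquiv UnimodalSeq.weight).hasSum_iff.mpr h
  refine h1.sigma fun n => ?_
  have : Finite {u : UnimodalSeq // u.weight = n} := (finite_weight n)
  have := Fintype.ofFinite {u : UnimodalSeq // u.weight = n}
  convert! hasSum_fintype _ using 1
  classical
  have h2 : ∀ u : {u : UnimodalSeq // u.weight = n},
      ((S.indicator fun u => q ^ u.weight) ∘ Equiv.sigmaFiberEquiv weight) ⟨n, u⟩ =
        if u.1 ∈ S then q ^ n else 0 := by
    intro u
    simp only [Function.comp_apply, Equiv.sigmaFiberEquiv, Equiv.coe_fn_mk, Set.indicator_apply,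
      u.2]
  simp only [h2]
  rw [Finset.sum_ite, Finset.sum_const_zero, add_zero, Finset.sum_const, nsmul_eq_mul]
  congr 2
  rw [← Set.ncard_coe_finset, ← Set.ncard_image_of_injective _ Subtype.val_injective]
  congr 1
  ext u
  simp
  tauto

lemma hasSum_fiber {q : ℂ} (hq : ‖q‖ < 1) (m : ℕ) :
    HasSum (fun p : OddLists (m + 1) × OddLists (m + 1) => q ^ (ofOddLists ⟨m, p⟩).weight)
      ((oddProd q (m + 1) - oddProd q m) * oddProd q (m + 1)) := by
  have h := OddLists.hasSum_pow_sum hq (m + 1)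
  have h2 := (hasSum_mul_prod h h).mul_left
    (q ^ (2 * m + 1))
  rw [oddProd_succ_sub hq, mul_assoc]
  refine h2.congr_fun fun p => ?_
  rw [weight_ofOddLists, pow_add, pow_add _ (List.sum _)]

/-- The condition affects the left list only: it contributes one increment, and the peak times the
right list contributes the other. -/
lemma hasSum_fiber_of_mem {q : ℂ} (hq : ‖q‖ < 1) (m : ℕ) :
    HasSum (fun p : OddLists (m + 1) × OddLists (m + 1) =>
      if (ofOddLists ⟨m, p⟩).peak ∈ (ofOddLists ⟨m, p⟩).left then
        q ^ (ofOddLists ⟨m, p⟩).weight else 0)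
      ((oddProd q (m + 1) - oddProd q m) ^ 2) := by
  have h := OddLists.hasSum_pow_sum hq (m + 1)
  have h' := OddLists.hasSum_pow_sum_of_mem hq m
  have h2 := (hasSum_mul_prod h' h).mul_left
    (q ^ (2 * m + 1))
  rw [show (oddProd q (m + 1) - oddProd q m) ^ 2 = q ^ (2 * m + 1) *
    ((oddProd q (m + 1) - oddProd q m) * oddProd q (m + 1)) by
      rw [sq]; nth_rw 2 [oddProd_succ_sub hq]; ring]
  refine h2.congr_fun fun p => ?_
  by_cases hm : 2 * m + 1 ∈ p.1.1
  · rw [if_pos (show (ofOddLists ⟨m, p⟩).peak ∈ (ofOddLists ⟨m, p⟩).left from hm), if_pos hm,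
      weight_ofOddLists, pow_add, pow_add _ (List.sum _)]
  · rw [if_neg (show ¬(ofOddLists ⟨m, p⟩).peak ∈ (ofOddLists ⟨m, p⟩).left from hm), if_neg hm,
      zero_mul, mul_zero]

/-- The norms form the same series at the real point |q|, where the sums over each peak are
dominated by a geometric series. -/
lemma summable_norm_pow_weight {q : ℂ} (hq : ‖q‖ < 1) :
    Summable fun x => ‖q ^ (ofOddLists x).weight‖ := by
  have hr : ‖((‖q‖ : ℝ) : ℂ)‖ < 1 := by simpa using hq
  have hfib : ∀ m : ℕ, HasSum (fun p : OddLists (m + 1) × OddLists (m + 1) =>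
      ‖q ^ (ofOddLists ⟨m, p⟩).weight‖)
      ((oddProd ‖q‖ (m + 1) - oddProd ‖q‖ m) * oddProd ‖q‖ (m + 1)) := by
    intro m
    have h := hasSum_fiber hr m
    simp only [← ofReal_oddProd] at h
    simp only [norm_pow]
    exact_mod_cast h
  rw [summable_sigma_of_nonneg fun _ => norm_nonneg _]
  refine ⟨fun m => (hfib m).summable, ?_⟩
  simp only [(hfib _).tsum_eq]
  have hg : Summable fun m : ℕ => ‖oddPartGF ‖q‖‖ ^ 2 * ‖q‖ ^ m :=
    (summable_geometric_of_lt_one (norm_nonneg _) hq).mul_left _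
  refine hg.of_nonneg_of_le (fun m => ?_) fun m => ?_
  · exact mul_nonneg (sub_nonneg.mpr (oddProd_monotone (norm_nonneg _) hq (Nat.le_succ m)))
      (oddProd_nonneg (norm_nonneg _) hq _)
  · rw [oddProd_succ_sub_real (norm_nonneg _) hq, mul_assoc, mul_comm, ← sq]
    have h1 := oddProd_nonneg (norm_nonneg q) hq (m + 1)
    have h2 := oddProd_le (norm_nonneg q) hq (m + 1)
    have h3 : ‖q‖ ^ (2 * m + 1) ≤ ‖q‖ ^ m :=
      pow_le_pow_of_le_one (norm_nonneg _) hq.le (by omega)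
    gcongr

lemma exists_hasSum_ou {q : ℂ} (hq : ‖q‖ < 1) :
    ∃ s, HasSum (fun n => (ou n : ℂ) * q ^ n) s ∧
      HasSum (fun m => (oddProd q (m + 1) - oddProd q m) * oddProd q (m + 1)) s := by
  have hs := (summable_norm_pow_weight hq).of_norm
  refine ⟨_, ?_, hs.hasSum.sigma fun m => hasSum_fiber hq m⟩
  refine hasSum_ncard_mul_pow (S := {u | u.IsOdd}) ?_
  rw [← ofOddLists_injective.hasSum_iff]
  · refine hs.hasSum.congr_fun fun x => ?_
    simp [isOdd_ofOddLists]
  · intro u hu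
    rw [Set.indicator_of_notMem]
    exact fun h => hu (exists_ofOddLists_eq h)

/-- The number of odd unimodal sequences of weight `n` with a part equal to the peak to the left
of the peak. -/
noncomputable def ouRepeated (n : ℕ) : ℕ :=
  {u : UnimodalSeq | u ∈ {u : UnimodalSeq | u.IsOdd ∧ u.peak ∈ u.left} ∧ u.weight = n}.ncard

lemma exists_hasSum_ouRepeated {q : ℂ} (hq : ‖q‖ < 1) :
    ∃ s, HasSum (fun n => (ouRepeated n : ℂ) * q ^ n) s ∧
      HasSum (fun m => (oddProd q (m + 1) - oddProd q m) ^ 2) s := by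
  have hs : Summable fun x => if (ofOddLists x).peak ∈ (ofOddLists x).left then
      q ^ (ofOddLists x).weight else 0 := by
    refine (summable_norm_pow_weight hq).of_norm_bounded fun x => ?_
    split_ifs
    · exact le_rfl
    · simp
  refine ⟨_, ?_, hs.hasSum.sigma fun m => hasSum_fiber_of_mem hq m⟩
  refine hasSum_ncard_mul_pow ?_
  rw [← ofOddLists_injective.hasSum_iff]
  · refine hs.hasSum.congr_fun fun x => ?_
    by_cases h : (ofOddLists x).peak ∈ (ofOddLists x).left
    · rw [if_pos h, Function.comp_apply, Set.indicator_of_mem (s := {u : UnimodalSeq | u.IsOdd ∧ u.peak ∈ u.left})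
        ⟨isOdd_ofOddLists x, h⟩]
    · rw [if_neg h, Function.comp_apply, Set.indicator_of_notMem fun hx => h hx.2]
  · intro u hu
    rw [Set.indicator_of_notMem]
    exact fun h => hu (exists_ofOddLists_eq h.1)

/-- Prepending a part 1 is injective, raises the weight by one and keeps the repeated peak. -/
lemma ouRepeated_monotone : Monotone ouRepeated := by
  refine monotone_nat_of_le_succ fun n => ?_
  let f : UnimodalSeq → UnimodalSeq := fun u =>
    { left := 1 :: u.left
      peak := u.peak
      right := u.right
      pos := by
        intro x hx
        rcases List.mem_cons.mp hx with rfl | hx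
        · exact one_pos
        · exact u.pos x hx
      left_le := List.pairwise_cons.mpr ⟨fun x hx => u.pos x (by
        rcases List.mem_append.mp hx with h | h
        · exact List.mem_append_left _ h
        · simp [List.mem_singleton.mp h]), u.left_le⟩
      right_ge := u.right_ge }
  refine Set.ncard_le_ncard_of_injOn f ?_ ?_ ((finite_weight (n + 1)).subset fun u hu => hu.2)
  · rintro u ⟨⟨h1, h2⟩, h3⟩
    refine ⟨⟨?_, List.mem_cons_of_mem _ h2⟩, ?_⟩
    · intro x hx
      rcases List.mem_cons.mp hx with rfl | hx
      · exact odd_one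
      · exact h1 x hx
    · change (1 :: u.entries).sum = n + 1
      rw [List.sum_cons, ← h3, add_comm]
      rfl
  · intro u _ v _ h
    refine UnimodalSeq.ext ?_ (congrArg peak h :) (congrArg right h :)
    exact (List.cons.inj (congrArg left h :)).2

end UnimodalSeq

/-! ### Sequences with a repeated peak are negligible -/

/-- The increments after index m+1 sum to at least P_{m+1} times the geometric series r^(2m+3)/(1 -
r²), and P_{m+1} plus these increments cannot exceed P. -/
lemma pow_mul_oddProd_le {r : ℝ} (h0 : 0 < r) (h1 : r < 1) (m : ℕ) :
    r ^ (2 * m + 1) * oddProd r (m + 1) ≤ (1 - r ^ 2) / r ^ 2 * ‖oddPartGF r‖ := by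
  have hmono := oddProd_monotone h0.le h1
  have hr2 : r ^ 2 < 1 := pow_lt_one₀ h0.le h1 two_ne_zero
  have hstep : ∀ k, oddProd r (m + 1) * ∑ i ∈ Finset.range k, r ^ (2 * m + 3) * (r ^ 2) ^ i ≤
      oddProd r (m + 1 + k) := by
    intro k
    induction k with
    | zero => simpa using oddProd_nonneg h0.le h1 (m + 1)
    | succ k ih =>
      rw [Finset.sum_range_succ, mul_add]
      have h2 := oddProd_succ_sub_real h0.le h1 (m + 1 + k)
      have h3 := hmono (show m + 1 ≤ m + 1 + k + 1 by omega)
      have h4 : r ^ (2 * m + 3) * (r ^ 2) ^ k = r ^ (2 * (m + 1 + k) + 1) := by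
        rw [← pow_mul, ← pow_add]; congr 1; ring
      have h5 := mul_le_mul_of_nonneg_left h3 (pow_nonneg h0.le (2 * (m + 1 + k) + 1))
      rw [h4, ← add_assoc]
      linarith
  have hgeo : HasSum (fun i => r ^ (2 * m + 3) * (r ^ 2) ^ i) (r ^ (2 * m + 3) * (1 - r ^ 2)⁻¹) :=
    (hasSum_geometric_of_lt_one (sq_nonneg r) hr2).mul_left _
  have hle := le_of_tendsto' (hgeo.tendsto_sum_nat.const_mul (oddProd r (m + 1)))
    fun k => (hstep k).trans (oddProd_le h0.le h1 _)
  have h3 : 0 < 1 - r ^ 2 := by linarith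
  calc r ^ (2 * m + 1) * oddProd r (m + 1)
      = (1 - r ^ 2) / r ^ 2 * (oddProd r (m + 1) * (r ^ (2 * m + 3) * (1 - r ^ 2)⁻¹)) := by
        field_simp; ring
    _ ≤ _ := by gcongr

namespace UnimodalSeq

/-- Monotone coefficients bound the series below by `ouRepeated n` · r^n/(1 - r). Above, each
squared increment is at most the largest-increment bound times the increment, and the increments
telescope. -/
lemma ouRepeated_mul_pow_le {r : ℝ} (h0 : 0 < r) (h1 : r < 1) (n : ℕ) :
    ouRepeated n * r ^ n ≤ (1 - r) * ((1 - r ^ 2) / r ^ 2) * ‖oddPartGF r‖ ^ 2 := by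
  have hr : ‖(r : ℂ)‖ < 1 := by simpa [abs_of_pos h0] using h1
  obtain ⟨s, hs1, hs2⟩ := exists_hasSum_ouRepeated hr
  obtain ⟨s', hs'⟩ : ∃ s' : ℝ,
      HasSum (fun m => (oddProd r (m + 1) - oddProd r m) ^ 2) s' := by
    have h := hs2.summable
    simp only [← ofReal_oddProd] at h
    exact ⟨_, Summable.hasSum (by exact_mod_cast h)⟩
  have hss : s = (s' : ℂ) := by
    refine hs2.unique ?_
    simp only [← ofReal_oddProd]
    exact_mod_cast hs'
  rw [hss] at hs1
  have hs : HasSum (fun n => (ouRepeated n : ℝ) * r ^ n) s' := by exact_mod_cast hs1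
  have hr2 : r ^ 2 < 1 := pow_lt_one₀ h0.le h1 two_ne_zero
  set B := (1 - r ^ 2) / r ^ 2 * ‖oddPartGF r‖ with hB
  have hB0 : 0 ≤ B := mul_nonneg (div_nonneg (by linarith) (sq_nonneg _)) (norm_nonneg _)
  have hupper : s' ≤ B * ‖oddPartGF r‖ := by
    refine le_of_tendsto' hs'.tendsto_sum_nat fun M => ?_
    have hterm : ∀ m, (oddProd r (m + 1) - oddProd r m) ^ 2 ≤
        B * (oddProd r (m + 1) - oddProd r m) := by
      intro m
      rw [sq]
      refine mul_le_mul_of_nonneg_right ?_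
        (sub_nonneg.mpr (oddProd_monotone h0.le h1 (Nat.le_succ m)))
      rw [oddProd_succ_sub_real h0.le h1]
      exact pow_mul_oddProd_le h0 h1 m
    calc _ ≤ ∑ m ∈ Finset.range M, B * (oddProd r (m + 1) - oddProd r m) :=
          Finset.sum_le_sum fun m _ => hterm m
      _ = B * (oddProd r M - oddProd r 0) := by
          rw [← Finset.mul_sum, Finset.sum_range_sub]
      _ ≤ B * ‖oddPartGF r‖ := by
          have h2 := oddProd_le h0.le h1 M
          have h3 := oddProd_nonneg h0.le h1 0
          gcongr
          linarith
  have hlower : ouRepeated n * r ^ n * (1 - r)⁻¹ ≤ s' := by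
    have hgeo := (hasSum_geometric_of_lt_one h0.le h1).mul_left ((ouRepeated n : ℝ) * r ^ n)
    refine (hasSum_le (fun k => ?_) hgeo
      ((hasSum_nat_add_iff' (f := fun n => (ouRepeated n : ℝ) * r ^ n) n).mpr hs)).trans ?_
    · have h2 : (ouRepeated n : ℝ) ≤ ouRepeated (k + n) := by
        exact_mod_cast ouRepeated_monotone (by omega)
      rw [mul_assoc, ← pow_add, add_comm n k]
      gcongr
    · have : 0 ≤ ∑ i ∈ Finset.range n, (ouRepeated i : ℝ) * r ^ i :=
        Finset.sum_nonneg fun i _ => by positivity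
      linarith
  have h3 : 0 < 1 - r := by linarith
  rw [← div_eq_mul_inv, div_le_iff₀ h3] at hlower
  calc _ ≤ s' * (1 - r) := hlower
    _ ≤ B * ‖oddPartGF r‖ * (1 - r) := by gcongr
    _ = _ := by rw [hB]; ring

/-- Up to the constant term, `2 ou - ouRepeated` counts pairs of partitions into odd parts. -/
lemma hasSum_oddPartGF_sq {q : ℂ} (hq : ‖q‖ < 1) :
    HasSum (fun n => ((2 * ou n - ouRepeated n + if n = 0 then 1 else 0 : ℝ) : ℂ) * q ^ n)
      (oddPartGF q ^ 2) := by
  obtain ⟨s, hs, hsm⟩ := exists_hasSum_ou hq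
  obtain ⟨s', hs', hsm'⟩ := exists_hasSum_ouRepeated hq
  have h1 : 2 * s - s' = oddPartGF q ^ 2 - 1 := by
    have h := ((hsm.mul_left 2).sub hsm').tendsto_sum_nat
    refine tendsto_nhds_unique h ?_
    refine (((tendsto_oddProd hq).pow 2).sub_const 1).congr fun M => ?_
    -- 2(b - a)b - (b - a)² = b² - a² for consecutive products a, b.
    have h2 : ∀ m, 2 * ((oddProd q (m + 1) - oddProd q m) * oddProd q (m + 1)) -
        (oddProd q (m + 1) - oddProd q m) ^ 2 = oddProd q (m + 1) ^ 2 - oddProd q m ^ 2 :=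
      fun m => by ring
    simp only [h2]
    rw [Finset.sum_range_sub fun m => oddProd q m ^ 2]
    simp [oddProd]
  -- The added constant term is the square of the empty product, left over from telescoping.
  have h3 := ((hs.mul_left 2).sub hs').add (hasSum_ite_eq 0 (1 : ℂ))
  rw [h1, sub_add_cancel] at h3
  refine h3.congr_fun fun n => ?_
  push_cast
  split_ifs with hn
  · subst hn; simp
  · simp; ring

/-- At r = e^(-w²) the factors 1 - r and (1 - r²)/r² are each O(w²), so after division by w³ a
factor w remains. -/
lemma tendsto_ouRepeated :
    Tendsto (fun n => ouRepeated n * Real.exp (-(2 * (Real.pi ^ 2 / 6) / saddle n ^ 2)) /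
      saddle n ^ 3) atTop (𝓝 0) := by
  have h1 : Tendsto (fun w : ℝ => 2 * Real.exp 2 * w *
      (‖oddPartGF (Complex.exp (-((w ^ 2 : ℝ) : ℂ)))‖ ^ 2 *
        Real.exp (-(Real.pi ^ 2 / 6 / w ^ 2)))) (𝓝[>] 0) (𝓝 0) := by
    have hw : Tendsto (fun w : ℝ => 2 * Real.exp 2 * w) (𝓝[>] 0) (𝓝 0) := by
      simpa using (tendsto_nhdsWithin_of_tendsto_nhds (tendsto_id (α := ℝ) (x := 𝓝 0))).const_mul
        (2 * Real.exp 2)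
    simpa using hw.mul tendsto_norm_oddPartGF_sq
  have h2 : ∀ᶠ w : ℝ in 𝓝[>] 0, w ≤ 1 :=
    (eventually_le_nhds (by norm_num : (0 : ℝ) < 1)).filter_mono nhdsWithin_le_nhds
  refine squeeze_zero' (.of_forall fun n => ?_) ?_ (h1.comp tendsto_saddle)
  · have : 0 ≤ saddle n := Real.sqrt_nonneg _
    positivity
  filter_upwards [eventually_gt_atTop 0, tendsto_saddle.eventually h2] with n hn hw1
  have hw := saddle_pos hn
  have hexp : Real.exp (-(2 * (Real.pi ^ 2 / 6) / saddle n ^ 2)) =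
      Real.exp (-saddle n ^ 2) ^ n * Real.exp (-(Real.pi ^ 2 / 6 / saddle n ^ 2)) := by
    rw [← Real.exp_nat_mul, ← Real.exp_add, mul_neg, natCast_mul_saddle_sq hn]
    congr 1
    ring
  set w := saddle n
  have hr1 : Real.exp (-w ^ 2) < 1 := by
    rw [← Real.exp_zero]
    exact Real.exp_lt_exp.mpr (by have := pow_pos hw 2; linarith)
  have h := ouRepeated_mul_pow_le (Real.exp_pos _) hr1 n
  have hcast : ((Real.exp (-w ^ 2) : ℝ) : ℂ) = Complex.exp (-((w ^ 2 : ℝ) : ℂ)) := by push_cast; rfl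
  rw [hcast] at h
  simp only [Function.comp_apply]
  rw [hexp, ← mul_assoc]
  set N := ‖oddPartGF (Complex.exp (-((w ^ 2 : ℝ) : ℂ)))‖ ^ 2
  have hN : 0 ≤ N := sq_nonneg _
  have ha : 1 - Real.exp (-w ^ 2) ≤ w ^ 2 := by
    have := Real.add_one_le_exp (-w ^ 2); linarith
  have hb : (1 - Real.exp (-w ^ 2) ^ 2) / Real.exp (-w ^ 2) ^ 2 ≤ 2 * Real.exp 2 * w ^ 2 := by
    rw [← Real.exp_nat_mul, div_le_iff₀ (Real.exp_pos _)]
    have h3 := Real.add_one_le_exp (((2 : ℕ) : ℝ) * -w ^ 2)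
    push_cast at h3 ⊢
    -- Here w ≤ 1 is used; it is the source of the constant e².
    have h4 : 1 ≤ Real.exp 2 * Real.exp (2 * -w ^ 2) := by
      rw [← Real.exp_add]
      exact Real.one_le_exp (by nlinarith)
    nlinarith [mul_le_mul_of_nonneg_left h4 (by positivity : 0 ≤ 2 * w ^ 2)]
  have hb0 : 0 ≤ 1 - Real.exp (-w ^ 2) := by linarith
  have hmain : ouRepeated n * Real.exp (-w ^ 2) ^ n ≤ w ^ 2 * (2 * Real.exp 2 * w ^ 2) * N := by
    have hb1 : 0 ≤ (1 - Real.exp (-w ^ 2) ^ 2) / Real.exp (-w ^ 2) ^ 2 :=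
      div_nonneg (sub_nonneg.mpr (pow_le_one₀ (Real.exp_pos _).le hr1.le)) (sq_nonneg _)
    refine h.trans ?_
    gcongr
  calc _ ≤ w ^ 2 * (2 * Real.exp 2 * w ^ 2) * N * Real.exp (-(Real.pi ^ 2 / 6 / w ^ 2)) / w ^ 3 := by
        gcongr
    _ = 2 * Real.exp 2 * w * (N * Real.exp (-(Real.pi ^ 2 / 6 / w ^ 2))) := by field_simp

end UnimodalSeq

/-! ### Conclusion -/

lemma tendsto_ou :
    Tendsto (fun n => ou n * Real.exp (-(2 * (Real.pi ^ 2 / 6) / saddle n ^ 2)) / saddle n ^ 3)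
      atTop (𝓝 (√(Real.pi / (Real.pi ^ 2 / 6)) / (8 * Real.pi))) := by
  have h1 := tendsto_coeff_oddPartGF_sq fun q hq => UnimodalSeq.hasSum_oddPartGF_sq hq
  have h := (h1.add UnimodalSeq.tendsto_ouRepeated).div_const 2
  have hlim : (√(Real.pi / (Real.pi ^ 2 / 6)) / (4 * Real.pi) + 0) / 2 =
      √(Real.pi / (Real.pi ^ 2 / 6)) / (8 * Real.pi) := by ring
  rw [hlim] at h
  refine h.congr' ?_
  filter_upwards [eventually_gt_atTop 0] with n hn
  rw [if_neg hn.ne']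
  ring

lemma exp_div_mul_saddle {n : ℕ} (hn : 0 < n) :
    Real.exp (Real.pi * Real.sqrt (2 * (n : ℝ) / 3)) /
        ((2 : ℝ) ^ ((13 : ℝ) / 4) * (3 : ℝ) ^ ((1 : ℝ) / 4) * (n : ℝ) ^ ((3 : ℝ) / 4)) *
      Real.exp (-(2 * (Real.pi ^ 2 / 6) / saddle n ^ 2)) / saddle n ^ 3 =
      √(Real.pi / (Real.pi ^ 2 / 6)) / (8 * Real.pi) := by
  have hpi := Real.pi_pos
  have hn' : (0 : ℝ) < n := by exact_mod_cast hn
  have hw := saddle_pos hn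
  have hw4 := saddle_pow_four n
  have hexp : Real.pi * Real.sqrt (2 * (n : ℝ) / 3) = 2 * (Real.pi ^ 2 / 6) / saddle n ^ 2 := by
    rw [mul_div_assoc 2 (Real.pi ^ 2 / 6), ← natCast_mul_saddle_sq hn]
    refine (pow_left_inj₀ (by positivity) (by positivity) two_ne_zero).mp ?_
    rw [mul_pow, Real.sq_sqrt (by positivity)]
    rw [show (2 * (n * saddle n ^ 2)) ^ 2 = 4 * n ^ 2 * saddle n ^ 4 by ring, hw4]
    field_simp
    norm_num
  have hroot : ∀ (x a : ℝ) (k : ℕ), 0 ≤ x → a * 4 = k → (x ^ a) ^ 4 = x ^ k := by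
    intro x a k hx ha
    rw [← Real.rpow_natCast, ← Real.rpow_mul hx, ← Real.rpow_natCast, Nat.cast_ofNat, ha]
  rw [hexp, div_mul_eq_mul_div, ← Real.exp_add, add_neg_cancel, Real.exp_zero]
  -- Fourth powers clear the fractional exponents and leave only w⁴ = A/n.
  refine (pow_left_inj₀ (by positivity) (by positivity) four_ne_zero).mp ?_
  rw [div_pow, div_pow, mul_pow, mul_pow, hroot 2 _ 13 (by norm_num) (by norm_num),
    hroot 3 _ 1 (by norm_num) (by norm_num), hroot n _ 3 hn'.le (by norm_num), div_pow,
    show √(Real.pi / (Real.pi ^ 2 / 6)) ^ 4 = (√(Real.pi / (Real.pi ^ 2 / 6)) ^ 2) ^ 2 by ring,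
    Real.sq_sqrt (by positivity), show (saddle n ^ 3) ^ 4 = (saddle n ^ 4) ^ 3 by ring, hw4]
  field_simp
  norm_num

theorem theorem3 :
    (fun n : ℕ => (ou n : ℝ)) ~[atTop]
      (fun n : ℕ => Real.exp (Real.pi * Real.sqrt (2 * (n : ℝ) / 3)) /
        ((2 : ℝ) ^ ((13 : ℝ) / 4) * (3 : ℝ) ^ ((1 : ℝ) / 4) * (n : ℝ) ^ ((3 : ℝ) / 4))) := by
  have hL : √(Real.pi / (Real.pi ^ 2 / 6)) / (8 * Real.pi) ≠ 0 := by
    have := Real.pi_pos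
    positivity
  refine isEquivalent_of_tendsto_one ?_
  have h := tendsto_ou.div_const (√(Real.pi / (Real.pi ^ 2 / 6)) / (8 * Real.pi))
  rw [div_self hL] at h
  refine h.congr' ?_
  filter_upwards [eventually_gt_atTop 0] with n hn
  have hw := saddle_pos hn
  rw [Pi.div_apply, ← exp_div_mul_saddle hn, mul_div_assoc (ou n : ℝ), mul_div_assoc (_ / _)]
  exact mul_div_mul_right _ _ (div_pos (Real.exp_pos _) (pow_pos hw 3)).ne'
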